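/- Let $R$ be an integral domain with quotient field $K$. Call an integral domain $D$ with quotient field $F$ an almost pseudo-valuation domain if every prime ideal $P$ of $D$ is strongly primary, i.e. for all $x,y\in F$ with $xy\in P$, either $x\in P$ or $y^{n}\in P$ for some positive integer $n$. Assume that $R$ is a locally almost pseudo-valuation domain, i.e. that the localization $R_{M}$ is an almost pseudo-valuation domain for every maximal ideal $M$ of $R$. Let $R^{*}$ be the complete integral closure of $R$ in $K$, i.e. the ring of all $x\in K$ for which there is a nonzero $r\in R$ with $rx^{n}\in R$ for all $n\ge 0$. Then $R$ is a Mori domain (i.e. $R$ satisfies the ascending chain condition on divisorial ideals, the nonzero ideals $I$ of $R$ with $I=R:(R:I)$, where $A:B=\{x\in K\mid xB\subseteq A\}$) if and only if both of the following conditions hold: 1. $R^{*}$ is a Dedekind domain (fields are counted as Dedekind domains); 2. the extension $R\subseteq R^{*}$ is unibranched, i.e. for each prime ideal $P$ of $R$ there is exactly one prime ideal $Q$ of $R^{*}$ with $Q\cap R=P$. -/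

import Mathlib

/-- For an integral domain `R` with quotient field `K`: an ideal `I` of `R` is strongly primary if
for all `x, y ∈ K` with `x y ∈ I` one has `x ∈ I` or `y ^ n ∈ I` for some positive integer `n`.
Here `I` is regarded as a subset of `K`. -/
def IsStronglyPrimary {R : Type*} [CommRing R] (K : Type*) [Field K] [Algebra R K]
    (I : Ideal R) : Prop :=
  ∀ x y : K, x * y ∈ IsLocalization.coeSubmodule K I →
    x ∈ IsLocalization.coeSubmodule K I ∨
      ∃ n : ℕ, 0 < n ∧ y ^ n ∈ IsLocalization.coeSubmodule K I

/-- Almost pseudo-valuation domain (APVD): an integral domain all of whose prime ideals are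
strongly primary. -/
structure IsAPVD (R : Type*) [CommRing R] : Prop where
  isDomain : IsDomain R
  stronglyPrimary : ∀ P : Ideal R, P.IsPrime → IsStronglyPrimary (FractionRing R) P

/-- Locally almost pseudo-valuation domain (LAPVD): an integral domain `R` such that `R_M` is an
APVD for each maximal ideal `M` of `R`. -/
structure IsLAPVD (R : Type*) [CommRing R] : Prop where
  isDomain : IsDomain R
  isAPVD_localization : ∀ (M : Ideal R) [M.IsMaximal], IsAPVD (Localization.AtPrime M)

/-- A divisorial ideal of an integral domain `R` with quotient field `K`: a nonzero ideal `I` of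
`R` with `R : (R : I) = I`. The quotient `A / B` of `R`-submodules of `K` is
`A : B = {x ∈ K | x B ⊆ A}`, and `1` is `R` regarded as a submodule of `K`. -/
def IsDivisorialIdeal {R : Type*} [CommRing R] (K : Type*) [Field K] [Algebra R K]
    (I : Ideal R) : Prop :=
  I ≠ ⊥ ∧
    (1 : Submodule R K) / ((1 : Submodule R K) / IsLocalization.coeSubmodule K I) =
      IsLocalization.coeSubmodule K I

/-- Mori domain: an integral domain with the ascending chain condition on divisorial ideals. -/
structure IsMoriDomain (R : Type*) [CommRing R] : Prop where
  isDomain : IsDomain R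
  acc : ∀ I : ℕ → Ideal R, Monotone I → (∀ n, IsDivisorialIdeal (FractionRing R) (I n)) →
    ∃ n, ∀ m, n ≤ m → I m = I n

/-- A ring extension `R ⊆ T` is unibranched if each prime ideal of `R` is the contraction of
exactly one prime ideal of `T`. -/
def IsUnibranched (R T : Type*) [CommRing R] [CommRing T] [Algebra R T] : Prop :=
  ∀ P : Ideal R, P.IsPrime → ∃! Q : Ideal T, Q.IsPrime ∧ Q.comap (algebraMap R T) = P

/-! Only strong primariness of the maximal ideals is used. For M maximal, put V_M = (M R_M : M R_M).
If neither x nor x⁻¹ lay in V_M, strong primariness would put positive powers of both in M R_M,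
hence also 1; so V_M is a valuation ring (`IsLocallyStronglyPrimary.idealizer`).

Let R be Mori and not a field. A residual R : S is then already the residual of a finite subset of S
(`IsMoriDomain.exists_finite_subset`). Since V_M is divisorial over R_M, every nonempty subset of
V_M has an element of largest value (`exists_valuation_max`), which makes V_M discrete. The same
finiteness shows that a nonzero element lies in finitely many maximal ideals
(`IsMoriDomain.finite_isMaximal_mem`). Hence R* is the intersection of the V_M and its localization
at M is V_M, so R* is Dedekind and the center of V_M is its only prime over M.

Conversely, let the primes of a Dedekind R* lie over all maximal ideals of R. A divisorial I is the
intersection with R of the local residuals R_M : (R : I). Along a chain these stabilize at each M,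
by a discrete valuation centered on M (`exists_forall_residual_eq`), and only the finitely many M
containing a fixed nonzero element of the first ideal matter. -/

open scoped nonZeroDivisors

/-! ### Localizations at primes as subrings of the quotient field. -/

section LocalSubalgebra

variable {R : Type*} [CommRing R] (K : Type*) [Field K] [Algebra R K]

/-- The localization of `R` at a prime ideal `M`, as a subalgebra of `K`. -/
def localSubalgebra (M : Ideal R) [hM : M.IsPrime] : Subalgebra R K where
  carrier := {x | ∃ s ∉ M, ∃ r, algebraMap R K s * x = algebraMap R K r}
  mul_mem' := by
    rintro x y ⟨s, hs, r, h⟩ ⟨t, ht, q, h'⟩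
    refine ⟨s * t, fun hst => (hM.mem_or_mem hst).elim hs ht, r * q, ?_⟩
    rw [map_mul, map_mul, ← h, ← h']; ring
  add_mem' := by
    rintro x y ⟨s, hs, r, h⟩ ⟨t, ht, q, h'⟩
    refine ⟨s * t, fun hst => (hM.mem_or_mem hst).elim hs ht, t * r + s * q, ?_⟩
    rw [map_mul, map_add, map_mul, map_mul, ← h, ← h']; ring
  algebraMap_mem' r := ⟨1, fun h => hM.ne_top ((Ideal.eq_top_iff_one _).2 h), r, by simp⟩

/-- The extension of a prime ideal `M` to `localSubalgebra K M`. -/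
def localIdeal (M : Ideal R) [hM : M.IsPrime] : Submodule R K where
  carrier := {x | ∃ s ∉ M, ∃ r ∈ M, algebraMap R K s * x = algebraMap R K r}
  add_mem' := by
    rintro x y ⟨s, hs, r, hr, h⟩ ⟨t, ht, q, hq, h'⟩
    refine ⟨s * t, fun hst => (hM.mem_or_mem hst).elim hs ht, t * r + s * q,
      add_mem (M.mul_mem_left _ hr) (M.mul_mem_left _ hq), ?_⟩
    rw [map_mul, map_add, map_mul, map_mul, ← h, ← h']; ring
  zero_mem' := ⟨1, fun h => hM.ne_top ((Ideal.eq_top_iff_one _).2 h), 0, zero_mem _, by simp⟩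
  smul_mem' := by
    rintro c x ⟨s, hs, r, hr, h⟩
    refine ⟨s, hs, c * r, M.mul_mem_left _ hr, ?_⟩
    rw [map_mul, ← h, Algebra.smul_def]; ring

variable {K}
variable {M : Ideal R} [hM : M.IsPrime]

theorem localIdeal_subset {x : K} (hx : x ∈ localIdeal K M) : x ∈ localSubalgebra K M := by
  obtain ⟨s, hs, r, -, h⟩ := hx
  exact ⟨s, hs, r, h⟩

theorem mul_mem_localIdeal {a x : K} (ha : a ∈ localSubalgebra K M) (hx : x ∈ localIdeal K M) :
    a * x ∈ localIdeal K M := by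
  obtain ⟨s, hs, r, hr, h⟩ := hx
  obtain ⟨t, ht, q, h'⟩ := ha
  refine ⟨t * s, fun hst => (hM.mem_or_mem hst).elim ht hs, q * r, M.mul_mem_left _ hr, ?_⟩
  rw [map_mul, map_mul, ← h, ← h']; ring

theorem algebraMap_mem_localIdeal_of_mem {r : R} (hr : r ∈ M) :
    algebraMap R K r ∈ localIdeal K M :=
  ⟨1, fun h => hM.ne_top ((Ideal.eq_top_iff_one _).2 h), r, hr, by simp⟩

theorem algebraMap_ne_zero_of_notMem [IsFractionRing R K] {M : Ideal R} {s : R} (hs : s ∉ M) :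
    algebraMap R K s ≠ 0 := by
  intro h
  rw [map_eq_zero_iff _ (IsFractionRing.injective R K)] at h
  exact hs (h ▸ zero_mem M)

theorem algebraMap_mem_localIdeal [IsFractionRing R K] {r : R} :
    algebraMap R K r ∈ localIdeal K M ↔ r ∈ M := by
  refine ⟨?_, algebraMap_mem_localIdeal_of_mem⟩
  rintro ⟨s, hs, q, hq, h⟩
  rw [← map_mul] at h
  have := IsFractionRing.injective R K h
  exact (hM.mem_or_mem (this ▸ hq : s * r ∈ M)).resolve_left hs

theorem one_notMem_localIdeal [IsFractionRing R K] : (1 : K) ∉ localIdeal K M := by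
  rw [← map_one (algebraMap R K), algebraMap_mem_localIdeal]
  exact fun h => hM.ne_top ((Ideal.eq_top_iff_one _).2 h)

theorem inv_mem_localSubalgebra [IsFractionRing R K] {s : R} (hs : s ∉ M) :
    (algebraMap R K s)⁻¹ ∈ localSubalgebra K M :=
  ⟨s, hs, 1, by rw [map_one, mul_inv_cancel₀ (algebraMap_ne_zero_of_notMem hs)]⟩

theorem inv_mem_localSubalgebra_of_notMem_localIdeal [IsFractionRing R K]
    {x : K} (hx : x ∈ localSubalgebra K M)
    (hx' : x ∉ localIdeal K M) : x⁻¹ ∈ localSubalgebra K M := by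
  obtain ⟨s, hs, r, h⟩ := hx
  have hr : r ∉ M := fun hr => hx' ⟨s, hs, r, hr, h⟩
  have hr0 := algebraMap_ne_zero_of_notMem (K := K) hr
  refine ⟨r, hr, s, ?_⟩
  have hx0 : x ≠ 0 := by
    rintro rfl
    exact hr0 (by rw [← h, mul_zero])
  rw [← h, mul_assoc, mul_inv_cancel₀ hx0, mul_one]

/-- An integral domain is the intersection of its localizations at maximal ideals. -/
theorem mem_range_of_forall_mem_localSubalgebra {x : K}
    (h : ∀ (M : Ideal R) [M.IsMaximal], x ∈ localSubalgebra K M) :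
    ∃ r, algebraMap R K r = x := by
  let I : Ideal R :=
    { carrier := {s | ∃ r, algebraMap R K r = algebraMap R K s * x}
      add_mem' := by
        rintro s t ⟨r, hr⟩ ⟨q, hq⟩
        exact ⟨r + q, by rw [map_add, map_add, hr, hq, add_mul]⟩
      zero_mem' := ⟨0, by simp⟩
      smul_mem' := by
        rintro c s ⟨r, hr⟩
        exact ⟨c * r, by rw [smul_eq_mul, map_mul, map_mul, hr, mul_assoc]⟩ }
  by_cases hI : I = ⊤
  · obtain ⟨r, hr⟩ := (Ideal.eq_top_iff_one I).1 hI
    exact ⟨r, by rw [hr, map_one, one_mul]⟩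
  · obtain ⟨M, hM, hIM⟩ := Ideal.exists_le_maximal I hI
    obtain ⟨s, hs, r, hr⟩ := h M
    exact (hs (hIM ⟨r, hr.symm⟩)).elim

/-- A common denominator exists because F is finite; this is why residuals are first reduced to
finite sets before localizing. -/
theorem exists_mul_mem_range_of_finite {F : Set K} (hF : F.Finite) {z : K}
    (h : ∀ f ∈ F, z * f ∈ localSubalgebra K M) :
    ∃ s ∉ M, ∀ f ∈ F, ∃ r, algebraMap R K r = algebraMap R K s * z * f := by
  induction F, hF using Set.Finite.induction_on with
  | empty => exact ⟨1, fun h => hM.ne_top ((Ideal.eq_top_iff_one _).2 h), by simp⟩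
  | @insert a F _ _ ih =>
    obtain ⟨s, hs, hsF⟩ := ih fun f hf => h f (Set.mem_insert_of_mem _ hf)
    obtain ⟨t, ht, r, hr⟩ := h a (Set.mem_insert _ _)
    refine ⟨s * t, fun hst => (hM.mem_or_mem hst).elim hs ht, ?_⟩
    rintro f (rfl | hf)
    · exact ⟨s * r, by rw [map_mul, map_mul, ← hr]; ring⟩
    · obtain ⟨q, hq⟩ := hsF f hf
      exact ⟨t * q, by rw [map_mul, map_mul, hq]; ring⟩

end LocalSubalgebra

/-! ### The valuation ring attached to a strongly primary ideal. -/

section Idealizer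

variable {R : Type*} [CommRing R] {K : Type*} [Field K] [Algebra R K]

/-- The extension of the prime ideal `M` to the localization of `R` at `M` is strongly primary. -/
def IsLocallyStronglyPrimary (K : Type*) [Field K] [Algebra R K] (M : Ideal R) [M.IsPrime] :
    Prop :=
  ∀ x y : K, x * y ∈ localIdeal K M → x ∈ localIdeal K M ∨ ∃ n, 0 < n ∧ y ^ n ∈ localIdeal K M

variable {M : Ideal R} [hM : M.IsPrime]

theorem pow_mem_localIdeal {x : K} (hx : x ∈ localIdeal K M) {n : ℕ} (hn : 0 < n) :
    x ^ n ∈ localIdeal K M := by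
  obtain ⟨n, rfl⟩ := Nat.exists_eq_succ_of_ne_zero hn.ne'
  rw [pow_succ]
  exact mul_mem_localIdeal (pow_mem (localIdeal_subset hx) n) hx

/-- Strong primariness is applied to the factorization p = (x p) · x⁻¹. -/
theorem IsLocallyStronglyPrimary.inv_pow_mem (h : IsLocallyStronglyPrimary K M) {x p : K}
    (hp : p ∈ localIdeal K M) (hxp : x * p ∉ localIdeal K M) :
    ∃ n, 0 < n ∧ x⁻¹ ^ n ∈ localIdeal K M := by
  have hx : x ≠ 0 := by
    rintro rfl
    exact hxp (by rw [zero_mul]; exact zero_mem _)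
  refine (h (x * p) x⁻¹ ?_).resolve_left hxp
  rwa [mul_comm x, mul_assoc, mul_inv_cancel₀ hx, mul_one]

variable [IsFractionRing R K]

/-- The idealizer of the maximal ideal of the localization of `R` at `M`, when that ideal
is strongly primary. -/
def IsLocallyStronglyPrimary.idealizer (h : IsLocallyStronglyPrimary K M) : ValuationSubring K where
  carrier := {x | ∀ p ∈ localIdeal K M, x * p ∈ localIdeal K M}
  mul_mem' := by
    intro x y hx hy p hp
    rw [mul_assoc]
    exact hx _ (hy _ hp)
  one_mem' := by simp
  add_mem' := by
    intro x y hx hy p hp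
    rw [add_mul]
    exact add_mem (hx _ hp) (hy _ hp)
  zero_mem' := by
    intro p _
    rw [zero_mul]
    exact zero_mem _
  neg_mem' := by
    intro x hx p hp
    rw [neg_mul]
    exact neg_mem (hx _ hp)
  mem_or_inv_mem' := by
    intro x
    by_contra! hcon
    obtain ⟨h1, h2⟩ := hcon
    simp only [Set.mem_ofPred_eq, not_forall] at h1 h2
    obtain ⟨p, hp, hxp⟩ := h1
    obtain ⟨q, hq, hxq⟩ := h2
    obtain ⟨n, hn, hn'⟩ := h.inv_pow_mem hp hxp
    obtain ⟨k, hk, hk'⟩ := h.inv_pow_mem hq hxq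
    have hx : x ≠ 0 := by
      rintro rfl
      exact hxp (by rw [zero_mul]; exact zero_mem _)
    rw [inv_inv] at hk'
    have h1 := mul_mem_localIdeal (localIdeal_subset (pow_mem_localIdeal hn' hk))
      (pow_mem_localIdeal hk' hn)
    rw [← pow_mul, ← pow_mul, mul_comm k n, ← mul_pow, inv_mul_cancel₀ hx, one_pow] at h1
    exact one_notMem_localIdeal h1

theorem IsLocallyStronglyPrimary.mem_idealizer (h : IsLocallyStronglyPrimary K M) {x : K} :
    x ∈ h.idealizer ↔ ∀ p ∈ localIdeal K M, x * p ∈ localIdeal K M := Iff.rfl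

theorem IsLocallyStronglyPrimary.mem_idealizer_of_mem (h : IsLocallyStronglyPrimary K M) {x : K}
    (hx : x ∈ localSubalgebra K M) : x ∈ h.idealizer :=
  fun _ hp => mul_mem_localIdeal hx hp

end Idealizer

/-! ### Independence of the chosen localization and quotient field. -/

section Transfer

variable {R : Type*} [CommRing R] (K : Type*) [Field K] [Algebra R K]
  [IsFractionRing R K]

theorem IsStronglyPrimary.isLocallyStronglyPrimary [IsDomain R] {M : Ideal R} [hM : M.IsPrime]
    (L : Type*) [CommRing L] [IsDomain L] [IsLocalRing L] [Algebra R L]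
    [IsLocalization.AtPrime L M]
    (h : IsStronglyPrimary (FractionRing L) (IsLocalRing.maximalIdeal L)) :
    IsLocallyStronglyPrimary K M := by
  have hu : ∀ s : M.primeCompl, IsUnit (algebraMap R K s) := fun s =>
    (algebraMap_ne_zero_of_notMem s.2).isUnit
  let : Algebra L K := (IsLocalization.lift hu).toAlgebra
  have : IsScalarTower R L K :=
    IsScalarTower.of_algebraMap_eq fun r => (IsLocalization.lift_eq hu r).symm
  have : IsFractionRing L K :=
    IsFractionRing.isFractionRing_of_isDomain_of_isLocalization M.primeCompl L K
  let e : FractionRing L ≃ₐ[L] K := IsLocalization.algEquiv L⁰ _ _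
  have key : ∀ z, z ∈ IsLocalization.coeSubmodule (FractionRing L)
      (IsLocalRing.maximalIdeal L) ↔ e z ∈ localIdeal K M := by
    intro z
    constructor
    · rintro ⟨l, hl, rfl⟩
      obtain ⟨⟨r, s⟩, hrs⟩ := IsLocalization.surj M.primeCompl l
      refine ⟨s, s.2, r, ?_, ?_⟩
      · rw [← IsLocalization.AtPrime.to_map_mem_maximal_iff L M, ← hrs]
        exact Ideal.mul_mem_right _ _ hl
      · rw [Algebra.linearMap_apply, AlgEquiv.commutes, IsScalarTower.algebraMap_apply R L K,
          IsScalarTower.algebraMap_apply R L K, ← map_mul, mul_comm, hrs]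
    · rintro ⟨s, hs, r, hr, h⟩
      refine ⟨IsLocalization.mk' L r (⟨s, hs⟩ : M.primeCompl), ?_, ?_⟩
      · exact (IsLocalization.AtPrime.mk'_mem_maximal_iff L M r ⟨s, hs⟩).2 hr
      · apply e.injective
        apply mul_left_cancel₀ (algebraMap_ne_zero_of_notMem (K := K) hs)
        rw [h, Algebra.linearMap_apply, AlgEquiv.commutes, IsScalarTower.algebraMap_apply R L K,
          IsScalarTower.algebraMap_apply R L K, ← map_mul]
        congr 1
        exact IsLocalization.mk'_spec' L r (⟨s, hs⟩ : M.primeCompl)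
  intro x y hxy
  obtain ⟨x, rfl⟩ := e.surjective x
  obtain ⟨y, rfl⟩ := e.surjective y
  simp only [← map_mul, ← map_pow, ← key] at hxy ⊢
  exact h _ _ hxy

theorem IsLAPVD.isLocallyStronglyPrimary [IsDomain R] (hR : IsLAPVD R) (M : Ideal R)
    [hM : M.IsMaximal] : IsLocallyStronglyPrimary K M := by
  have hL := hR.isAPVD_localization M
  have := hL.isDomain
  exact (hL.stronglyPrimary _ inferInstance).isLocallyStronglyPrimary K (Localization.AtPrime M)

theorem isDivisorialIdeal_iff (F : Type*) [Field F] [Algebra R F] [IsFractionRing R F]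
    (I : Ideal R) : IsDivisorialIdeal F I ↔ IsDivisorialIdeal K I := by
  let e : F ≃ₐ[R] K := IsLocalization.algEquiv R⁰ F K
  have he : ∀ I : Ideal R, (IsLocalization.coeSubmodule F I).map e.toLinearMap =
      IsLocalization.coeSubmodule K I := by
    intro I
    rw [IsLocalization.coeSubmodule, IsLocalization.coeSubmodule, ← Submodule.map_comp]
    congr 1
    ext
    simp
  have h1 : (1 : Submodule R F).map e.toLinearMap = 1 := Submodule.map_one e.toAlgHom
  refine and_congr_right fun _ => ?_
  rw [← (Submodule.map_injective_of_injective (f := e.toLinearMap) e.injective).eq_iff]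
  rw [Submodule.map_div, Submodule.map_div, h1, he]

end Transfer

section Mori

variable {R : Type*} [CommRing R] [IsDomain R] (K : Type*) [Field K] [Algebra R K]
  [IsFractionRing R K]

theorem isMoriDomain_iff : IsMoriDomain R ↔ ∀ I : ℕ → Ideal R, Monotone I →
    (∀ n, IsDivisorialIdeal K (I n)) → ∃ n, ∀ m, n ≤ m → I m = I n := by
  refine ⟨fun h I hI hd => h.acc I hI fun n => (isDivisorialIdeal_iff K _ _).2 (hd n),
    fun h => ⟨inferInstance, fun I hI hd => h I hI fun n => (isDivisorialIdeal_iff K _ _).1 (hd n)⟩⟩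

end Mori

/-! ### Discrete valuations centered on a strongly primary ideal. -/

section Valuation

variable {R : Type*} [CommRing R] {K : Type*} [Field K] [Algebra R K]
  {M : Ideal R} [hM : M.IsPrime] {v : Valuation K (WithZero (Multiplicative ℤ))}

section

variable (hv : ∀ r, v (algebraMap R K r) ≤ 1) (hvM : ∀ r, v (algebraMap R K r) < 1 ↔ r ∈ M)
include hv hvM

theorem valuation_le_one_of_mem_localSubalgebra {x : K} (hx : x ∈ localSubalgebra K M) :
    v x ≤ 1 := by
  obtain ⟨s, hs, r, h⟩ := hx
  have h1 : v (algebraMap R K s) = 1 := le_antisymm (hv s) (not_lt.1 fun h => hs ((hvM s).1 h))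
  have h2 := congrArg v h
  rw [map_mul, h1, one_mul] at h2
  exact h2 ▸ hv r

theorem valuation_lt_one_of_mem_localIdeal {x : K} (hx : x ∈ localIdeal K M) : v x < 1 := by
  obtain ⟨s, hs, r, hr, h⟩ := hx
  have h1 : v (algebraMap R K s) = 1 := le_antisymm (hv s) (not_lt.1 fun h => hs ((hvM s).1 h))
  have h2 := congrArg v h
  rw [map_mul, h1, one_mul] at h2
  exact h2 ▸ (hvM r).2 hr

theorem IsLocallyStronglyPrimary.mul_mem_of_valuation_le_one (h : IsLocallyStronglyPrimary K M)
    {x p : K} (hx : v x ≤ 1) (hp : p ∈ localIdeal K M) : x * p ∈ localIdeal K M := by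
  by_contra hxp
  obtain ⟨n, hn, hn'⟩ := h.inv_pow_mem hp hxp
  have hx0 : x ≠ 0 := by
    rintro rfl
    exact hxp (by rw [zero_mul]; exact zero_mem _)
  have h1 := valuation_lt_one_of_mem_localIdeal hv hvM hn'
  rw [map_pow, map_inv₀] at h1
  have h2 : (1 : WithZero (Multiplicative ℤ)) ≤ (v x)⁻¹ :=
    (one_le_inv₀ (zero_lt_iff.2 ((map_ne_zero v).2 hx0))).2 hx
  exact absurd h1 (not_lt.2 (one_le_pow₀ h2))

variable [IsFractionRing R K] in
/-- An ascending chain of residuals `localSubalgebra K M : J n` stabilizes if `v` is a discrete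
valuation on `K` centered on the strongly primary ideal `M`. -/
theorem IsLocallyStronglyPrimary.exists_forall_residual_eq (h : IsLocallyStronglyPrimary K M)
    {J : ℕ → Submodule R K} (hJ : Antitone J) (h1 : ∀ n, 1 ∈ J n) {a : K} (ha0 : a ≠ 0)
    (ha : ∀ j ∈ J 0, a * j ∈ localSubalgebra K M) :
    ∃ n, ∀ m ≥ n, ∀ x : K, (∀ j ∈ J m, x * j ∈ localSubalgebra K M) →
      ∀ j ∈ J n, x * j ∈ localSubalgebra K M := by
  -- Take y of largest value among the nonzero elements of all the residuals. The bound 0 on the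
  -- logarithm comes from 1 ∈ J n, which puts every residual inside R_M.
  obtain ⟨k, ⟨n, y, hy, hy0, rfl⟩, hmax⟩ := Int.exists_greatest_of_bdd
    (P := fun k => ∃ n, ∃ y : K, (∀ j ∈ J n, y * j ∈ localSubalgebra K M) ∧ y ≠ 0 ∧
      WithZero.log (v y) = k) ⟨0, by
        rintro _ ⟨n, y, hy, hy0, rfl⟩
        rw [← WithZero.log_one, WithZero.log_le_log ((map_ne_zero v).2 hy0) one_ne_zero]
        have := hy 1 (h1 n)
        rw [mul_one] at this
        exact valuation_le_one_of_mem_localSubalgebra hv hvM this⟩ ⟨_, 0, a, ha, ha0, rfl⟩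
  have hle : ∀ m, ∀ z : K, (∀ j ∈ J m, z * j ∈ localSubalgebra K M) → v (z / y) ≤ 1 := by
    intro m z hz
    rcases eq_or_ne z 0 with rfl | hz0
    · simp
    · have := hmax _ ⟨m, z, hz, hz0, rfl⟩
      rw [WithZero.log_le_log ((map_ne_zero v).2 hz0) ((map_ne_zero v).2 hy0)] at this
      rw [map_div₀]
      exact div_le_one_of_le₀ this zero_le
  -- If y J_k ⊆ M R_M for some k ≥ n, then z j = (z / y)(y j) with z / y of value at most 1.
  -- Otherwise each later J_m has an i with y i a unit of R_M, and z j = (z i)(y i)⁻¹(y j).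
  by_cases hcase : ∃ k ≥ n, ∀ j ∈ J k, y * j ∈ localIdeal K M
  · obtain ⟨k, -, hk⟩ := hcase
    refine ⟨k, fun m _ z hz j hj => ?_⟩
    have := h.mul_mem_of_valuation_le_one hv hvM (hle m z hz) (hk j hj)
    rw [← mul_assoc, div_mul_cancel₀ _ hy0] at this
    exact localIdeal_subset this
  · push Not at hcase
    refine ⟨n, fun m hm z hz j hj => ?_⟩
    obtain ⟨i, hi, hyi⟩ := hcase m hm
    have hyi' := hy i (hJ hm hi)
    have hne : y * i ≠ 0 := fun h0 => hyi (h0 ▸ zero_mem _)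
    have hi0 : i ≠ 0 := right_ne_zero_of_mul hne
    have := mul_mem (mul_mem (hz i hi)
      (inv_mem_localSubalgebra_of_notMem_localIdeal hyi' hyi)) (hy j hj)
    have e : z * i * (y * i)⁻¹ * (y * j) = z * j := by field_simp
    rwa [e] at this

end

end Valuation

/-! ### A Dedekind overring with lying over forces the Mori property. -/

section Converse

variable {R : Type*} [CommRing R] [IsDomain R] (K : Type*) [Field K] [Algebra R K]
  [IsFractionRing R K]

theorem isMoriDomain_of_isField (hR : IsField R) : IsMoriDomain R := by
  refine ⟨inferInstance, fun I _ hd => ⟨0, fun m _ => ?_⟩⟩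
  let := hR.toField
  rw [(Ideal.eq_bot_or_top (I m)).resolve_left (hd m).1,
    (Ideal.eq_bot_or_top (I 0)).resolve_left (hd 0).1]

open IsDedekindDomain in
theorem IsLAPVD.isMoriDomain (hR : IsLAPVD R) (T : Type*) [CommRing T] [IsDedekindDomain T]
    [Algebra R T] [Algebra T K] [IsScalarTower R T K] [IsFractionRing T K]
    (hT : ∀ (M : Ideal R) [M.IsMaximal],
      ∃ Q : Ideal T, Q.IsPrime ∧ Q.comap (algebraMap R T) = M) :
    IsMoriDomain R := by
  by_cases hF : IsField R
  · exact isMoriDomain_of_isField hF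
  have hinj : Function.Injective (algebraMap R T) := by
    have := IsFractionRing.injective R K
    rw [IsScalarTower.algebraMap_eq R T K] at this
    exact Function.Injective.of_comp this
  have hspec : ∀ (M : Ideal R) [M.IsMaximal],
      ∃ w : HeightOneSpectrum T, w.asIdeal.comap (algebraMap R T) = M := by
    intro M hM
    obtain ⟨Q, hQ, hQM⟩ := hT M
    refine ⟨⟨Q, hQ, ?_⟩, hQM⟩
    rintro rfl
    rw [Ideal.comap_bot_of_injective _ hinj] at hQM
    exact Ring.ne_bot_of_isMaximal_of_not_isField hM hF hQM.symm
  -- Each such M is the contraction of one of the finitely many primes of T dividing a.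
  have hfin : ∀ a : R, a ≠ 0 → {M : Ideal R | M.IsMaximal ∧ a ∈ M}.Finite := by
    intro a ha
    have h0 : Ideal.span {algebraMap R T a} ≠ 0 := by
      rw [Ne, Ideal.zero_eq_bot, Ideal.span_singleton_eq_bot, map_eq_zero_iff _ hinj]
      exact ha
    refine ((Ideal.finite_factors h0).image fun w => w.asIdeal.comap (algebraMap R T)).subset ?_
    rintro M ⟨hM, haM⟩
    obtain ⟨w, rfl⟩ := hspec M
    refine ⟨w, ?_, rfl⟩
    rw [Set.mem_ofPred_eq, Ideal.dvd_span_singleton]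
    exact haM
  rw [isMoriDomain_iff K]
  intro I hI hd
  let J : ℕ → Submodule R K := fun n => 1 / IsLocalization.coeSubmodule K (I n)
  have hJ : Antitone J := fun m n hmn x hx y hy =>
    hx y (IsLocalization.coeSubmodule_mono K (hI hmn) hy)
  have hJ1 : ∀ n, (1 : K) ∈ J n := by
    rintro n _ ⟨r, -, rfl⟩
    exact Submodule.mem_one.2 ⟨r, by simp⟩
  have hmem : ∀ n r, r ∈ I n ↔ ∀ (M : Ideal R) [M.IsMaximal], ∀ j ∈ J n,
      algebraMap R K r * j ∈ localSubalgebra K M := by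
    intro n r
    have h1 : r ∈ I n ↔ algebraMap R K r ∈ IsLocalization.coeSubmodule K (I n) := by
      rw [IsLocalization.mem_coeSubmodule]
      refine ⟨fun h => ⟨r, h, rfl⟩, ?_⟩
      rintro ⟨q, hq, h⟩
      rwa [← IsFractionRing.injective R K h]
    rw [h1, ← (hd n).2, Submodule.mem_div_iff_forall_mul_mem]
    constructor
    · intro h M _ j hj
      obtain ⟨q, hq⟩ := Submodule.mem_one.1 (h j hj)
      rw [← hq]
      exact Subalgebra.algebraMap_mem _ _
    · intro h j hj
      exact Submodule.mem_one.2 (mem_range_of_forall_mem_localSubalgebra fun M _ => h M j hj)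
  obtain ⟨a, haI, ha0⟩ := Submodule.exists_mem_ne_zero_of_ne_bot (hd 0).1
  have hloc : ∀ (M : Ideal R) (_ : M.IsMaximal), ∃ n, ∀ m ≥ n, ∀ x : K,
      (∀ j ∈ J m, x * j ∈ localSubalgebra K M) → ∀ j ∈ J n, x * j ∈ localSubalgebra K M := by
    intro M hM
    obtain ⟨w, hw⟩ := hspec M
    have hv : ∀ r, w.valuation K (algebraMap R K r) ≤ 1 := by
      intro r
      rw [IsScalarTower.algebraMap_apply R T K]
      exact w.valuation_le_one _
    have hvM : ∀ r, w.valuation K (algebraMap R K r) < 1 ↔ r ∈ M := by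
      intro r
      rw [IsScalarTower.algebraMap_apply R T K, ← hw]
      exact w.valuation_lt_one_iff_mem _
    refine (hR.isLocallyStronglyPrimary K M).exists_forall_residual_eq hv hvM hJ hJ1
      (a := algebraMap R K a) ?_ ((hmem 0 a).1 haI M)
    rwa [Ne, map_eq_zero_iff _ (IsFractionRing.injective R K)]
  choose N hN using hloc
  classical
  let S := (hfin a ha0).toFinset.attach
  have hS : ∀ M, M ∈ (hfin a ha0).toFinset → M.IsMaximal := fun M hM =>
    ((Set.Finite.mem_toFinset _).1 hM).1
  let n₀ := S.sup fun M => N M.1 (hS M.1 M.2)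
  refine ⟨n₀, fun m hm => le_antisymm (fun r hr => ?_) (hI hm)⟩
  rw [hmem] at hr ⊢
  intro M hM j hj
  by_cases haM : a ∈ M
  · have hMS : M ∈ (hfin a ha0).toFinset := (Set.Finite.mem_toFinset _).2 ⟨hM, haM⟩
    have hle : N M hM ≤ n₀ := Finset.le_sup (f := fun M => N M.1 (hS M.1 M.2))
      (Finset.mem_attach _ (⟨M, hMS⟩ : {x // x ∈ (hfin a ha0).toFinset}))
    exact hN M hM m (hle.trans hm) _ (hr M) j (hJ hle hj)
  -- Here a is a unit of R_M and a j ∈ R_M, so j itself lies in R_M and M imposes no condition.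
  · have h1 := (hmem n₀ a).1 (hI (Nat.zero_le _) haI) M j hj
    have h2 := mul_mem (inv_mem_localSubalgebra (K := K) haM) h1
    rw [inv_mul_cancel_left₀ (algebraMap_ne_zero_of_notMem haM)] at h2
    exact mul_mem (Subalgebra.algebraMap_mem _ _) h2

end Converse

/-! ### Divisorial hulls and finite subsets with the same residual. -/

section DivisorialHull

variable {R : Type*} [CommRing R] (K : Type*) [Field K] [Algebra R K]

/-- The divisorial hull `R : (R : S)` of a subset `S` of `R`. -/
def divisorialHull (S : Set R) : Ideal R where
  carrier := {r | ∀ z : K, (∀ f ∈ S, z * algebraMap R K f ∈ (algebraMap R K).range) →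
    z * algebraMap R K r ∈ (algebraMap R K).range}
  add_mem' := by
    intro r q hr hq z hz
    rw [map_add, mul_add]
    exact add_mem (hr z hz) (hq z hz)
  zero_mem' := by
    intro z _
    rw [map_zero, mul_zero]
    exact zero_mem _
  smul_mem' := by
    intro c r hr z hz
    rw [smul_eq_mul, map_mul, mul_left_comm]
    exact mul_mem ⟨c, rfl⟩ (hr z hz)

theorem subset_divisorialHull {S : Set R} {s : R} (hs : s ∈ S) : s ∈ divisorialHull K S :=
  fun _ hz => hz s hs

theorem divisorialHull_mono {S T : Set R} (h : S ⊆ T) : divisorialHull K S ≤ divisorialHull K T :=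
  fun _ hr z hz => hr z fun f hf => hz f (h hf)

theorem isDivisorialIdeal_divisorialHull [IsFractionRing R K] {S : Set R} {s : R} (hs : s ∈ S)
    (hs0 : s ≠ 0) : IsDivisorialIdeal K (divisorialHull K S) := by
  refine ⟨fun h => hs0 ?_, le_antisymm ?_ ?_⟩
  · rw [← Ideal.mem_bot, ← h]
    exact subset_divisorialHull K hs
  · intro x hx
    have hz : ∀ z : K, (∀ f ∈ S, z * algebraMap R K f ∈ (algebraMap R K).range) →
        x * z ∈ (algebraMap R K).range := by
      intro z hz
      obtain ⟨q, hq⟩ := Submodule.mem_one.1 (hx z (by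
        rintro _ ⟨r, hr, rfl⟩
        obtain ⟨q, hq⟩ := hr z hz
        exact Submodule.mem_one.2 ⟨q, hq⟩))
      exact ⟨q, hq⟩
    obtain ⟨r, hr⟩ := hz 1 fun f _ => ⟨f, by rw [one_mul]⟩
    rw [mul_one] at hr
    refine ⟨r, fun z hz' => ?_, hr⟩
    rw [hr, mul_comm]
    exact hz z hz'
  · intro x hx y hy
    rw [mul_comm]
    exact hy x hx

variable [IsDomain R] [IsFractionRing R K]

/-- In a Mori domain, the residual of a set `S` is the residual of a finite subset of `S`. -/
theorem IsMoriDomain.exists_finite_subset (hR : IsMoriDomain R) {S : Set R} {s : R} (hs : s ∈ S)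
    (hs0 : s ≠ 0) : ∃ F ⊆ S, F.Finite ∧ s ∈ F ∧ ∀ z : K,
      (∀ f ∈ F, z * algebraMap R K f ∈ (algebraMap R K).range) →
        ∀ f ∈ S, z * algebraMap R K f ∈ (algebraMap R K).range := by
  have hwf : WellFoundedGT {I : Ideal R // IsDivisorialIdeal K I} := by
    rw [wellFoundedGT_iff_monotone_chain_condition]
    intro a
    obtain ⟨n, hn⟩ := (isMoriDomain_iff K).1 hR (fun n => (a n).1) (fun _ _ h => a.2 h)
      fun n => (a n).2
    exact ⟨n, fun m hm => Subtype.ext (hn m hm).symm⟩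
  -- A maximal hull among those of finite subsets containing s; adjoining any f ∈ S cannot enlarge
  -- it. Keeping s ≠ 0 in F makes the hulls nonzero.
  obtain ⟨I, ⟨F, hFS, hF, hsF, hI⟩, hmax⟩ := hwf.wf.has_min
    {I | ∃ F ⊆ S, F.Finite ∧ s ∈ F ∧ I.1 = divisorialHull K F}
    ⟨⟨_, isDivisorialIdeal_divisorialHull K (Set.mem_singleton s) hs0⟩, {s}, by simpa using hs,
      Set.finite_singleton s, rfl, rfl⟩
  refine ⟨F, hFS, hF, hsF, fun z hz f hf => ?_⟩
  by_contra hcon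
  refine hmax ⟨_, isDivisorialIdeal_divisorialHull K (Set.mem_insert_of_mem f hsF) hs0⟩
    ⟨insert f F, Set.insert_subset hf hFS, hF.insert f, Set.mem_insert_of_mem f hsF, rfl⟩ ?_
  change I.1 < _
  rw [hI]
  refine lt_of_le_not_ge (divisorialHull_mono K (Set.subset_insert f F)) fun hle => hcon ?_
  exact hle (subset_divisorialHull K (Set.mem_insert f F)) z hz

end DivisorialHull

/-! ### Over a Mori domain the idealizer is discrete. -/

section Idealizer

variable {R : Type*} [CommRing R] {K : Type*} [Field K] [Algebra R K]
  [IsFractionRing R K] {M : Ideal R} [hM : M.IsPrime]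

namespace IsLocallyStronglyPrimary

section

variable (h : IsLocallyStronglyPrimary K M)

theorem algebraMap_mem_idealizer (r : R) : algebraMap R K r ∈ h.idealizer :=
  h.mem_idealizer_of_mem (Subalgebra.algebraMap_mem _ _)

theorem valuation_algebraMap_of_notMem {s : R} (hs : s ∉ M) :
    h.idealizer.valuation (algebraMap R K s) = 1 := by
  refine le_antisymm ((h.idealizer.valuation_le_one_iff _).2 (h.algebraMap_mem_idealizer s)) ?_
  have h1 := (h.idealizer.valuation_le_one_iff _).2
    (h.mem_idealizer_of_mem (inv_mem_localSubalgebra (K := K) hs))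
  rw [map_inv₀] at h1
  exact (inv_le_one₀ (zero_lt_iff.2 ((map_ne_zero _).2 (algebraMap_ne_zero_of_notMem hs)))).1 h1

theorem valuation_lt_one_of_mem_localIdeal {x : K} (hx : x ∈ localIdeal K M) :
    h.idealizer.valuation x < 1 := by
  refine lt_of_le_of_ne ((h.idealizer.valuation_le_one_iff _).2
    (h.mem_idealizer_of_mem (localIdeal_subset hx))) fun h1 => ?_
  have h0 : x ≠ 0 := by
    rintro rfl
    simp at h1
  have h2 : x⁻¹ ∈ h.idealizer := by
    rw [← ValuationSubring.valuation_le_one_iff, map_inv₀, h1, inv_one]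
  have := h2 x hx
  rw [inv_mul_cancel₀ h0] at this
  exact one_notMem_localIdeal this

theorem valuation_algebraMap_lt_one_iff {r : R} :
    h.idealizer.valuation (algebraMap R K r) < 1 ↔ r ∈ M := by
  refine ⟨fun h1 => ?_, fun hr =>
    h.valuation_lt_one_of_mem_localIdeal (algebraMap_mem_localIdeal_of_mem hr)⟩
  by_contra hr
  exact h1.ne (h.valuation_algebraMap_of_notMem hr)

/-- The idealizer of the maximal ideal is a divisorial fractional ideal. -/
theorem mem_idealizer_of_forall_mul_mem {y : K}
    (hy : ∀ z : K, (∀ x ∈ h.idealizer, z * x ∈ localSubalgebra K M) →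
      y * z ∈ localSubalgebra K M) : y ∈ h.idealizer := by
  by_contra hcon
  rw [h.mem_idealizer] at hcon
  push Not at hcon
  obtain ⟨p, hp, hyp⟩ := hcon
  have hmul : ∀ q ∈ localIdeal K M, y * q ∈ localSubalgebra K M := fun q hq =>
    hy q fun x hx => by
      rw [mul_comm]
      exact localIdeal_subset (hx q hq)
  -- Since y p is a unit of R_M, x = (y x p)(y p)⁻¹ shows V_M = R_M. Then z = 1 gives y ∈ R_M,
  -- against y p ∉ M R_M.
  have hle : ∀ x ∈ h.idealizer, x ∈ localSubalgebra K M := by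
    intro x hx
    have h1 := mul_mem (hmul _ (hx p hp))
      (inv_mem_localSubalgebra_of_notMem_localIdeal (hmul p hp) hyp)
    have hne : y * p ≠ 0 := fun h0 => hyp (h0 ▸ zero_mem _)
    have hy0 := left_ne_zero_of_mul hne
    have hp0 := right_ne_zero_of_mul hne
    have e : y * (x * p) * (y * p)⁻¹ = x := by field_simp
    rwa [e] at h1
  have h1 := hy 1 fun x hx => by
    rw [one_mul]
    exact hle x hx
  rw [mul_one] at h1
  exact hyp (mul_mem_localIdeal h1 hp)

/-- Multiplying S by a nonzero c ∈ M and by denominators outside M, which are units of V_M, moves it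
into R without changing the comparison of values. A finite subset with the same residual has an
element f of largest value, and f dominates the whole set because V_M is divisorial. -/
theorem exists_valuation_max [IsDomain R] (hR : IsMoriDomain R) (hM0 : M ≠ ⊥) {S : Set K}
    (hS : ∀ x ∈ S, x ∈ h.idealizer) (hne : S.Nonempty) :
    ∃ s ∈ S, ∀ t ∈ S, h.idealizer.valuation t ≤ h.idealizer.valuation s := by
  by_cases h0 : ∀ s ∈ S, s = 0
  · obtain ⟨s, hs⟩ := hne
    exact ⟨s, hs, fun t ht => by rw [h0 t ht, h0 s hs]⟩
  push Not at h0
  obtain ⟨s₁, hs₁, hs₁0⟩ := h0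
  obtain ⟨c, hc, hc0⟩ := Submodule.exists_mem_ne_zero_of_ne_bot hM0
  have hinj := IsFractionRing.injective R K
  have hcK : algebraMap R K c ≠ 0 := (map_ne_zero_iff _ hinj).2 hc0
  have hnum : ∀ s ∈ S, ∃ r, ∃ t ∉ M,
      algebraMap R K r = algebraMap R K t * (algebraMap R K c * s) := by
    intro s hs
    obtain ⟨t, ht, r, hr⟩ := localIdeal_subset (hS s hs _ (algebraMap_mem_localIdeal_of_mem hc))
    exact ⟨r, t, ht, by rw [← hr, mul_comm s]⟩
  let J : Set R := {r | ∃ s ∈ S, ∃ t ∉ M,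
    algebraMap R K r = algebraMap R K t * (algebraMap R K c * s)}
  obtain ⟨r₁, t₁, ht₁, hr₁⟩ := hnum s₁ hs₁
  have hr₁0 : r₁ ≠ 0 := by
    rw [← map_ne_zero_iff _ hinj, hr₁]
    exact mul_ne_zero (algebraMap_ne_zero_of_notMem ht₁) (mul_ne_zero hcK hs₁0)
  obtain ⟨F, hFJ, hF, hrF, hFz⟩ := hR.exists_finite_subset K (S := J) ⟨s₁, hs₁, t₁, ht₁, hr₁⟩ hr₁0
  obtain ⟨f, hfF, hfmax⟩ := Set.exists_max_image F
    (fun r => h.idealizer.valuation (algebraMap R K r)) hF ⟨_, hrF⟩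
  have hf0 : algebraMap R K f ≠ 0 := by
    intro h0
    have h1 := hfmax _ hrF
    rw [h0, map_zero, le_zero_iff, map_eq_zero, map_eq_zero_iff _ hinj] at h1
    exact hr₁0 h1
  have hdiv : ∀ {r q : R}, algebraMap R K q ≠ 0 →
      (algebraMap R K r / algebraMap R K q ∈ h.idealizer ↔
      h.idealizer.valuation (algebraMap R K r) ≤ h.idealizer.valuation (algebraMap R K q)) := by
    intro r q hq
    rw [← ValuationSubring.valuation_le_one_iff, map_div₀,
      div_le_one₀ (zero_lt_iff.2 ((map_ne_zero _).2 hq))]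
  obtain ⟨s, hs, t, ht, hfs⟩ := hFJ hfF
  refine ⟨s, hs, fun s' hs' => ?_⟩
  obtain ⟨r, t', ht', hr⟩ := hnum s' hs'
  suffices hle : h.idealizer.valuation (algebraMap R K r) ≤
      h.idealizer.valuation (algebraMap R K f) by
    rw [hr, hfs, map_mul, map_mul, map_mul, map_mul, h.valuation_algebraMap_of_notMem ht,
      h.valuation_algebraMap_of_notMem ht', one_mul, one_mul] at hle
    exact (mul_le_mul_iff_right₀ (zero_lt_iff.2 ((map_ne_zero _).2 hcK))).1 hle
  rw [← hdiv hf0]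
  refine h.mem_idealizer_of_forall_mul_mem fun z hz => ?_
  -- For g ∈ F, g / f ∈ V_M gives (z / f) g ∈ R_M. Once u clears denominators, u z / f lies in the
  -- residual of F, hence in that of J.
  obtain ⟨u, hu, huF⟩ := exists_mul_mem_range_of_finite (M := M) (hF.image (algebraMap R K))
    (z := z / algebraMap R K f) (by
      rintro _ ⟨g, hg, rfl⟩
      rw [div_mul_eq_mul_div, mul_div_assoc]
      exact hz _ ((hdiv hf0).2 (hfmax g hg)))
  obtain ⟨q, hq⟩ := hFz (algebraMap R K u * (z / algebraMap R K f))
    (fun g hg => huF _ ⟨g, hg, rfl⟩) r ⟨s', hs', t', ht', hr⟩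
  refine ⟨u, hu, q, ?_⟩
  rw [hq]
  ring

/-- Otherwise the inverses of the pⁿ y would form a subset of V_M with strictly increasing values.
This is the archimedean property of the value group. -/
theorem exists_pow_mul_mem_idealizer [IsDomain R] (hR : IsMoriDomain R) (hM0 : M ≠ ⊥) {p : K}
    (hp : h.idealizer.valuation p < 1) (y : K) : ∃ n, p ^ n * y ∈ h.idealizer := by
  by_contra! hcon
  have hgt : ∀ n, 1 < h.idealizer.valuation (p ^ n * y) := fun n => by
    rw [← not_le, ValuationSubring.valuation_le_one_iff]
    exact hcon n
  obtain ⟨_, ⟨n, rfl⟩, hmax⟩ := h.exists_valuation_max hR hM0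
    (S := Set.range fun n => (p ^ n * y)⁻¹) (by
      rintro _ ⟨n, rfl⟩
      dsimp only
      rw [← ValuationSubring.valuation_le_one_iff, map_inv₀]
      exact inv_le_one_of_one_le₀ (hgt n).le) (Set.range_nonempty _)
  have h1 := hmax _ ⟨n + 1, rfl⟩
  dsimp only at h1
  rw [map_inv₀, map_inv₀, inv_le_inv₀ (zero_lt_one.trans (hgt _)) (zero_lt_one.trans (hgt _)),
    pow_succ', mul_assoc, map_mul] at h1
  exact absurd (mul_lt_of_lt_one_left (zero_lt_one.trans (hgt n)) hp) (not_lt.2 h1)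

end

/-- If `M` is a nonzero prime ideal of a Mori domain whose localization is strongly primary, then
`R : M` is strictly larger than `R`. -/
theorem exists_mul_mem_range_of_notMem_range [IsDomain R]
    (h : IsLocallyStronglyPrimary K M) (hR : IsMoriDomain R) (hM0 : M ≠ ⊥) :
    ∃ y : K, (∀ r ∈ M, y * algebraMap R K r ∈ (algebraMap R K).range) ∧
      y ∉ (algebraMap R K).range := by
  by_contra! hcon
  obtain ⟨c, hc, hc0⟩ := Submodule.exists_mem_ne_zero_of_ne_bot hM0
  obtain ⟨F, hFM, hF, -, hFz⟩ := hR.exists_finite_subset K (S := (M : Set R)) hc hc0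
  have hle : ∀ x : K, (∀ p ∈ localIdeal K M, x * p ∈ localSubalgebra K M) →
      x ∈ localSubalgebra K M := by
    intro x hx
    obtain ⟨t, ht, htF⟩ := exists_mul_mem_range_of_finite (M := M) (hF.image (algebraMap R K))
      (z := x) (by
        rintro _ ⟨g, hg, rfl⟩
        exact hx _ (algebraMap_mem_localIdeal_of_mem (hFM hg)))
    obtain ⟨q, hq⟩ := hcon _ (hFz (algebraMap R K t * x) fun g hg => htF _ ⟨g, hg, rfl⟩)
    exact ⟨t, ht, q, hq.symm⟩
  have hcm : algebraMap R K c ∈ localIdeal K M := algebraMap_mem_localIdeal_of_mem hc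
  obtain ⟨p, hp, hmax⟩ := h.exists_valuation_max hR hM0 (S := (localIdeal K M : Set K))
    (fun x hx => h.mem_idealizer_of_mem (localIdeal_subset hx)) ⟨_, hcm⟩
  have hp0 : p ≠ 0 := by
    rintro rfl
    have h1 := hmax _ hcm
    rw [map_zero, le_zero_iff, map_eq_zero, map_eq_zero_iff _ (IsFractionRing.injective R K)] at h1
    exact hc0 h1
  -- By maximality of p, p⁻¹ · M R_M ⊆ V_M, and V_M maps M R_M into itself; so R_M : M R_M = R_M is
  -- used twice.
  have hpinv : p⁻¹ ∈ localSubalgebra K M := by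
    refine hle _ fun q hq => hle _ fun p' hp' => localIdeal_subset ?_
    refine (?_ : p⁻¹ * q ∈ h.idealizer) p' hp'
    rw [← ValuationSubring.valuation_le_one_iff, map_mul, map_inv₀,
      inv_mul_le_one₀ (zero_lt_iff.2 ((map_ne_zero _).2 hp0))]
    exact hmax q hq
  have := mul_mem_localIdeal hpinv hp
  rw [inv_mul_cancel₀ hp0] at this
  exact one_notMem_localIdeal this

end IsLocallyStronglyPrimary

end Idealizer

theorem Ideal.exists_notMem_of_finite_isMaximal {R : Type*} [CommRing R] {M : Ideal R}
    [hM : M.IsMaximal] {G : Set (Ideal R)} (hG : G.Finite)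
    (hGM : ∀ M' ∈ G, M'.IsMaximal ∧ M' ≠ M) : ∃ s ∉ M, ∀ M' ∈ G, s ∈ M' := by
  induction G, hG using Set.Finite.induction_on with
  | empty => exact ⟨1, fun h => hM.ne_top ((Ideal.eq_top_iff_one _).2 h), by simp⟩
  | @insert a G _ _ ih =>
    obtain ⟨s, hs, hsG⟩ := ih fun M' h => hGM M' (Set.mem_insert_of_mem _ h)
    obtain ⟨ha, haM⟩ := hGM a (Set.mem_insert _ _)
    obtain ⟨t, hta, htM⟩ := SetLike.not_le_iff_exists.1
      fun h => haM (ha.eq_of_le hM.ne_top h)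
    refine ⟨s * t, fun h => (hM.isPrime.mem_or_mem h).elim hs htM, ?_⟩
    rintro M' (rfl | hM')
    · exact Ideal.mul_mem_left _ _ hta
    · exact Ideal.mul_mem_right _ _ (hsG M' hM')

/-! ### Finite character, and the complete integral closure as an intersection of valuation rings.
-/

section Global

variable {R : Type*} [CommRing R] {K : Type*} [Field K] [Algebra R K] [IsFractionRing R K]
  (hR : IsMoriDomain R)
  (H : ∀ (M : Ideal R) [M.IsMaximal], IsLocallyStronglyPrimary K M)

-- For each maximal M containing b pick y_M in R : M outside R, and reduce {b} ∪ {y_M b} to a finite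
-- subset indexed by G. If M ∉ G, some s ∉ M lies in all members of G; then s / b is in the finite
-- residual, so s y_M ∈ R. With y_M M ⊆ R and M + (s) = R this gives y_M ∈ R, a contradiction.
include hR H in
theorem IsMoriDomain.finite_isMaximal_mem [IsDomain R] {b : R} (hb : b ≠ 0) :
    {M : Ideal R | M.IsMaximal ∧ b ∈ M}.Finite := by
  classical
  have hex : ∀ M : Ideal R, ∃ y : K, M.IsMaximal ∧ b ∈ M →
      (∀ r ∈ M, y * algebraMap R K r ∈ (algebraMap R K).range) ∧
      y ∉ (algebraMap R K).range := by
    intro M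
    by_cases hM : M.IsMaximal ∧ b ∈ M
    · have := hM.1
      obtain ⟨y, hy⟩ := (H M).exists_mul_mem_range_of_notMem_range hR
        (fun h0 => hb (by rw [h0] at hM; exact hM.2))
      exact ⟨y, fun _ => hy⟩
    · exact ⟨0, fun h => absurd h hM⟩
  choose y hy using hex
  have hex' : ∀ M : Ideal R, ∃ r : R, M.IsMaximal ∧ b ∈ M →
      algebraMap R K r = y M * algebraMap R K b := by
    intro M
    by_cases hM : M.IsMaximal ∧ b ∈ M
    · obtain ⟨r, hr⟩ := (hy M hM).1 b hM.2
      exact ⟨r, fun _ => hr⟩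
    · exact ⟨0, fun h => absurd h hM⟩
  choose g hg using hex'
  obtain ⟨F, hFS, hF, -, hFz⟩ := hR.exists_finite_subset K
    (S := insert b (g '' {M : Ideal R | M.IsMaximal ∧ b ∈ M})) (Set.mem_insert _ _) hb
  have hF' : ((hF.toFinset.erase b : Finset R) : Set R) ⊆
      g '' {M : Ideal R | M.IsMaximal ∧ b ∈ M} := by
    intro f hf
    rw [Finset.mem_coe, Finset.mem_erase, Set.Finite.mem_toFinset] at hf
    exact (hFS hf.2).resolve_left hf.1
  obtain ⟨G, hGsub, hG⟩ := Finset.subset_set_image_iff.1 hF'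
  refine G.finite_toSet.subset fun M hM => ?_
  by_contra hMG
  have := hM.1
  obtain ⟨s, hsM, hsG⟩ := Ideal.exists_notMem_of_finite_isMaximal (M := M) G.finite_toSet
    fun M' hM' => ⟨(hGsub hM').1, by rintro rfl; exact hMG hM'⟩
  have hbK : algebraMap R K b ≠ 0 := (map_ne_zero_iff _ (IsFractionRing.injective R K)).2 hb
  have h1 : algebraMap R K s / algebraMap R K b * algebraMap R K (g M) ∈
      (algebraMap R K).range := by
    refine hFz _ (fun f hf => ?_) _ (Set.mem_insert_of_mem _ ⟨M, hM, rfl⟩)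
    by_cases hfb : f = b
    · exact ⟨s, by rw [hfb, div_mul_cancel₀ _ hbK]⟩
    · have hfG : f ∈ G.image g := by
        rw [hG, Finset.mem_erase, Set.Finite.mem_toFinset]
        exact ⟨hfb, hf⟩
      obtain ⟨M', hM', rfl⟩ := Finset.mem_image.1 hfG
      obtain ⟨q, hq⟩ := (hy M' (hGsub hM')).1 s (hsG M' hM')
      refine ⟨q, ?_⟩
      rw [hq, hg M' (hGsub hM')]
      field_simp
  rw [hg M hM] at h1
  have e : algebraMap R K s / algebraMap R K b * (y M * algebraMap R K b) =
      y M * algebraMap R K s := by field_simp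
  rw [e] at h1
  obtain ⟨x, m, hm, hx⟩ := hM.1.exists_inv hsM
  apply (hy M hM).2
  have h2 := add_mem (mul_mem (⟨x, rfl⟩ : algebraMap R K x ∈ (algebraMap R K).range) h1)
    ((hy M hM).1 m hm)
  have e' : algebraMap R K x * (y M * algebraMap R K s) + y M * algebraMap R K m =
      y M * algebraMap R K (x * s + m) := by
    rw [map_add, map_mul]
    ring
  rwa [e', hx, map_one, mul_one] at h2

/-- A denominator b of y serves as the multiplier: if b ∈ M then b yⁿ ∈ M R_M, and if b ∉ M then y ∈
R_M. -/
theorem mem_completeIntegralClosure_of_forall_mem_idealizer {y : K}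
    (hy : ∀ (M : Ideal R) [M.IsMaximal], y ∈ (H M).idealizer) :
    y ∈ completeIntegralClosure R K := by
  obtain ⟨a, b, hb, rfl⟩ := IsFractionRing.div_surjective (A := R) y
  refine ⟨b, hb, fun n => ?_⟩
  rw [Algebra.smul_def]
  refine mem_range_of_forall_mem_localSubalgebra fun M _ => ?_
  by_cases hbM : b ∈ M
  · rw [mul_comm]
    exact localIdeal_subset
      ((pow_mem (hy M) n : _ ∈ (H M).idealizer) _ (algebraMap_mem_localIdeal_of_mem hbM))
  · rw [div_eq_mul_inv]
    exact mul_mem (Subalgebra.algebraMap_mem _ _) (pow_mem (mul_mem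
      (Subalgebra.algebraMap_mem _ _) (inv_mem_localSubalgebra hbM)) n)

include hR in
theorem IsLocallyStronglyPrimary.completeIntegralClosure_subset_idealizer [IsDomain R] {M : Ideal R}
    [M.IsPrime] (h : IsLocallyStronglyPrimary K M) (hM0 : M ≠ ⊥) {x : K}
    (hx : x ∈ completeIntegralClosure R K) : x ∈ h.idealizer := by
  obtain ⟨r, hr, hrx⟩ := hx
  have hr0 : algebraMap R K r ≠ 0 :=
    (map_ne_zero_iff _ (IsFractionRing.injective R K)).2 (nonZeroDivisors.ne_zero hr)
  have hrx' : ∀ n, algebraMap R K r * x ^ n ∈ h.idealizer := by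
    intro n
    obtain ⟨q, hq⟩ := hrx n
    rw [← Algebra.smul_def, ← hq]
    exact h.algebraMap_mem_idealizer q
  by_contra hxV
  have hlt : 1 < h.idealizer.valuation x := by
    rwa [← not_le, ValuationSubring.valuation_le_one_iff]
  have hx0 : x ≠ 0 := by
    rintro rfl
    exact hxV (zero_mem _)
  have hinv : h.idealizer.valuation x⁻¹ < 1 := by
    rw [map_inv₀]
    exact inv_lt_one_of_one_lt₀ hlt
  -- Multiplying x⁻ⁿ r⁻¹ ∈ V_M by r xⁿ⁺¹ ∈ V_M recovers x.
  obtain ⟨n, hn⟩ := h.exists_pow_mul_mem_idealizer hR hM0 hinv (algebraMap R K r)⁻¹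
  have := mul_mem hn (hrx' (n + 1))
  have e : x⁻¹ ^ n * (algebraMap R K r)⁻¹ * (algebraMap R K r * x ^ (n + 1)) = x := by
    rw [inv_pow, pow_succ]
    field_simp
  rw [e] at this
  exact hxV this

-- With y = a / b, only the finitely many maximal M' ≠ M containing b can obstruct, and a power of
-- some t ∈ M' \ M removes each obstruction. Thus R* localized at M is all of V_M.
include hR in
theorem exists_mul_mem_completeIntegralClosure [IsDomain R] {M : Ideal R} [hM : M.IsMaximal]
    {y : K} (hy : y ∈ (H M).idealizer) :
    ∃ s ∉ M, algebraMap R K s * y ∈ completeIntegralClosure R K := by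
  obtain ⟨a, b, hb, hab⟩ := IsFractionRing.div_surjective (A := R) y
  have hb0 := nonZeroDivisors.ne_zero hb
  have key : ∀ G : Set (Ideal R), G.Finite → (∀ M' ∈ G, M' ≠ M ∧ b ∈ M') → ∃ s ∉ M,
      ∀ M' ∈ G, ∀ _ : M'.IsMaximal, algebraMap R K s * y ∈ (H M').idealizer := by
    intro G hG
    induction G, hG using Set.Finite.induction_on with
    | empty => exact fun _ => ⟨1, fun h => hM.ne_top ((Ideal.eq_top_iff_one _).2 h), by simp⟩
    | @insert N G _ _ ih =>
      intro hGM
      obtain ⟨s, hs, hsG⟩ := ih fun M' h => hGM M' (Set.mem_insert_of_mem _ h)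
      obtain ⟨hNM, hbN⟩ := hGM N (Set.mem_insert _ _)
      have hmul : ∀ t : R, ∀ M' ∈ G, ∀ _ : M'.IsMaximal,
          algebraMap R K (t * s) * y ∈ (H M').idealizer := by
        intro t M' hM' hmax
        rw [map_mul, mul_assoc]
        exact mul_mem ((H M').algebraMap_mem_idealizer t) (hsG M' hM' hmax)
      by_cases hN : N.IsMaximal
      · obtain ⟨t, htN, htM⟩ := SetLike.not_le_iff_exists.1
          fun h => hNM (hN.eq_of_le hM.ne_top h)
        obtain ⟨n, hn⟩ := (H N).exists_pow_mul_mem_idealizer hR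
          (fun h0 => hb0 (by rw [h0] at hbN; exact hbN))
          ((H N).valuation_algebraMap_lt_one_iff.2 htN) y
        refine ⟨t ^ n * s, fun h => (hM.isPrime.mem_or_mem h).elim
          (fun h => htM (hM.isPrime.mem_of_pow_mem n h)) hs, ?_⟩
        rintro M' (rfl | hM') hM'max
        · rw [mul_comm (t ^ n), map_mul, map_pow, mul_assoc]
          exact mul_mem ((H M').algebraMap_mem_idealizer s) hn
        · exact hmul _ M' hM' hM'max
      · refine ⟨s, hs, ?_⟩
        rintro M' (rfl | hM') hM'max
        · exact absurd hM'max hN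
        · exact hsG M' hM' hM'max
  obtain ⟨s, hs, hsG⟩ := key {M' | (M'.IsMaximal ∧ b ∈ M') ∧ M' ≠ M}
    ((hR.finite_isMaximal_mem H hb0).subset fun _ h => h.1) fun M' h => ⟨h.2, h.1.2⟩
  refine ⟨s, hs, mem_completeIntegralClosure_of_forall_mem_idealizer H fun M' _ => ?_⟩
  by_cases hbM' : b ∈ M'
  · by_cases hMM' : M' = M
    · subst hMM'
      exact mul_mem ((H M').algebraMap_mem_idealizer s) hy
    · exact hsG M' ⟨⟨inferInstance, hbM'⟩, hMM'⟩ inferInstance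
  · refine (H M').mem_idealizer_of_mem ?_
    rw [← hab, div_eq_mul_inv]
    exact mul_mem (Subalgebra.algebraMap_mem _ _)
      (mul_mem (Subalgebra.algebraMap_mem _ _) (inv_mem_localSubalgebra hbM'))

end Global

/-! ### The complete integral closure is Dedekind and unibranched over R. -/

section Dedekind

variable {R : Type*} [CommRing R] {K : Type*} [Field K] [Algebra R K] [IsFractionRing R K]

theorem algebraMap_completeIntegralClosure_injective :
    Function.Injective (algebraMap R (completeIntegralClosure R K)) := fun _ _ h =>
  IsFractionRing.injective R K (congrArg Subtype.val h)

variable [IsDomain R] (hR : IsMoriDomain R)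
  (H : ∀ (M : Ideal R) [M.IsMaximal], IsLocallyStronglyPrimary K M)
  (hbot : ∀ (M : Ideal R) [M.IsMaximal], M ≠ ⊥)

include hR hbot

theorem valuation_le_one_of_mem_completeIntegralClosure (M : Ideal R) [M.IsMaximal]
    (t : completeIntegralClosure R K) : (H M).idealizer.valuation (t : K) ≤ 1 :=
  ((H M).idealizer.valuation_le_one_iff _).2
    ((H M).completeIntegralClosure_subset_idealizer hR (hbot M) t.2)

omit hbot in
/-- Divisibility in the localization of the complete integral closure at `M` is detected by the
valuation of the idealizer. -/
theorem exists_algebraMap_mul_eq_mul (M : Ideal R) [M.IsMaximal]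
    {x i : completeIntegralClosure R K}
    (hle : (H M).idealizer.valuation (x : K) ≤ (H M).idealizer.valuation (i : K)) :
    ∃ s ∉ M, ∃ u, algebraMap R (completeIntegralClosure R K) s * x = u * i := by
  by_cases hi : (i : K) = 0
  · refine ⟨1, fun h => Ideal.IsPrime.ne_top inferInstance ((Ideal.eq_top_iff_one _).2 h), 0, ?_⟩
    rw [hi, map_zero, le_zero_iff, map_eq_zero] at hle
    have hx : x = 0 := Subtype.ext hle
    rw [hx, mul_zero, zero_mul]
  · have hV : (x : K) / i ∈ (H M).idealizer := by
      rw [← ValuationSubring.valuation_le_one_iff, map_div₀,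
        div_le_one₀ (zero_lt_iff.2 ((map_ne_zero _).2 hi))]
      exact hle
    obtain ⟨s, hs, hsu⟩ := exists_mul_mem_completeIntegralClosure hR H hV
    refine ⟨s, hs, ⟨_, hsu⟩, Subtype.ext ?_⟩
    change algebraMap R K s * (x : K) = algebraMap R K s * ((x : K) / i) * i
    field_simp

/-- Up to a factor outside M, an element of value 1 divides 1, and any nonzero q ∈ Q divides a power
of an element of value < 1. Both dimension one and uniqueness of the prime over M follow. -/
theorem mem_iff_valuation_lt_one {M : Ideal R} [M.IsMaximal]
    {Q : Ideal (completeIntegralClosure R K)} [hQ : Q.IsPrime] (hQ0 : Q ≠ ⊥)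
    (hQM : Q.comap (algebraMap R (completeIntegralClosure R K)) ≤ M)
    {t : completeIntegralClosure R K} : t ∈ Q ↔ (H M).idealizer.valuation (t : K) < 1 := by
  constructor
  · intro ht
    refine lt_of_le_of_ne (valuation_le_one_of_mem_completeIntegralClosure hR H hbot M t)
      fun h1 => ?_
    obtain ⟨s, hs, u, hu⟩ := exists_algebraMap_mul_eq_mul hR H M (x := 1) (i := t) (by
      rw [h1, OneMemClass.coe_one, map_one])
    rw [mul_one] at hu
    exact hs (hQM (by rw [Ideal.mem_comap, hu]; exact Q.mul_mem_left _ ht))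
  · intro ht
    obtain ⟨q, hq, hq0⟩ := Submodule.exists_mem_ne_zero_of_ne_bot hQ0
    have hq0' : (q : K) ≠ 0 := fun h => hq0 (Subtype.ext h)
    obtain ⟨n, hn⟩ := (H M).exists_pow_mul_mem_idealizer hR (hbot M) ht (q : K)⁻¹
    obtain ⟨s, hs, u, hu⟩ := exists_algebraMap_mul_eq_mul hR H M (x := t ^ n) (i := q) (by
      rw [← ValuationSubring.valuation_le_one_iff, map_mul, map_inv₀, ← div_eq_mul_inv,
        div_le_one₀ (zero_lt_iff.2 ((map_ne_zero _).2 hq0'))] at hn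
      exact hn)
    have h1 : algebraMap R (completeIntegralClosure R K) s * t ^ n ∈ Q := by
      rw [hu]
      exact Q.mul_mem_left _ hq
    exact hQ.mem_of_pow_mem n ((hQ.mem_or_mem h1).resolve_left fun h => hs (hQM h))

omit hbot in
-- The colon ideal I : t contracts to an ideal of R contained in no maximal ideal.
theorem mem_of_forall_valuation_le {I : Ideal (completeIntegralClosure R K)}
    {t : completeIntegralClosure R K}
    (h : ∀ (M : Ideal R) [M.IsMaximal], ∃ i ∈ I,
      (H M).idealizer.valuation (t : K) ≤ (H M).idealizer.valuation (i : K)) : t ∈ I := by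
  let J : Ideal R := (I.colon {t}).comap (algebraMap R (completeIntegralClosure R K))
  have hJ : ∀ r, r ∈ J ↔ algebraMap R (completeIntegralClosure R K) r * t ∈ I := fun r => by
    rw [Ideal.mem_comap, Submodule.mem_colon_singleton, smul_eq_mul]
  by_cases htop : J = ⊤
  · simpa using (hJ 1).1 ((Ideal.eq_top_iff_one J).1 htop)
  · obtain ⟨M, hM, hJM⟩ := Ideal.exists_le_maximal J htop
    obtain ⟨i, hi, hle⟩ := h M
    obtain ⟨s, hs, u, hu⟩ := exists_algebraMap_mul_eq_mul hR H M hle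
    refine absurd (hJM ((hJ s).2 ?_)) hs
    rw [hu]
    exact I.mul_mem_left _ hi

include H

theorem isNoetherianRing_completeIntegralClosure :
    IsNoetherianRing (completeIntegralClosure R K) := by
  rw [isNoetherianRing_iff_ideal_fg]
  intro I
  by_cases hI : I = ⊥
  · rw [hI]
    exact Submodule.fg_bot
  obtain ⟨a, ha, ha0⟩ := Submodule.exists_mem_ne_zero_of_ne_bot hI
  obtain ⟨c, b, hb, hcb⟩ := IsFractionRing.div_surjective (A := R) (a : K)
  have hc0 : c ≠ 0 := by
    rintro rfl
    rw [map_zero, zero_div] at hcb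
    exact ha0 (Subtype.ext hcb.symm)
  have hex : ∀ M : Ideal R, ∃ i ∈ I, ∀ _ : M.IsMaximal, ∀ j ∈ I,
      (H M).idealizer.valuation (j : K) ≤ (H M).idealizer.valuation (i : K) := by
    intro M
    by_cases hM : M.IsMaximal
    · obtain ⟨_, ⟨i, hi, rfl⟩, hmax⟩ := (H M).exists_valuation_max hR (hbot M)
        (S := Subtype.val '' (I : Set (completeIntegralClosure R K))) (by
          rintro _ ⟨x, -, rfl⟩
          exact (H M).completeIntegralClosure_subset_idealizer hR (hbot M) x.2)
        ⟨_, a, ha, rfl⟩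
      exact ⟨i, hi, fun _ j hj => hmax _ ⟨j, hj, rfl⟩⟩
    · exact ⟨a, ha, fun h => absurd h hM⟩
  choose i hiI hi using hex
  -- With a = c / b, the element a has value at least 1 at every M not containing c, so extra
  -- generators are needed only at the finitely many M ∋ c.
  refine Submodule.fg_def.2 ⟨insert a (i '' {M | M.IsMaximal ∧ c ∈ M}),
    ((hR.finite_isMaximal_mem H hc0).image i).insert a, le_antisymm ?_ ?_⟩
  · rw [Submodule.span_le]
    rintro _ (rfl | ⟨M, -, rfl⟩)
    · exact ha
    · exact hiI M
  · intro t ht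
    refine mem_of_forall_valuation_le hR H fun M hM => ?_
    by_cases hcM : c ∈ M
    · exact ⟨i M, Submodule.subset_span (Set.mem_insert_of_mem _ ⟨M, ⟨hM, hcM⟩, rfl⟩),
        hi M hM t ht⟩
    · refine ⟨a, Submodule.subset_span (Set.mem_insert _ _),
        (valuation_le_one_of_mem_completeIntegralClosure hR H hbot M t).trans ?_⟩
      rw [← hcb, map_div₀, (H M).valuation_algebraMap_of_notMem hcM, one_div]
      have hbK : algebraMap R K b ≠ 0 :=
        (map_ne_zero_iff _ (IsFractionRing.injective R K)).2 (nonZeroDivisors.ne_zero hb)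
      exact (one_le_inv₀ (zero_lt_iff.2 ((map_ne_zero _).2 hbK))).2
        (((H M).idealizer.valuation_le_one_iff _).2 ((H M).algebraMap_mem_idealizer b))

theorem isIntegrallyClosed_completeIntegralClosure :
    IsIntegrallyClosed (completeIntegralClosure R K) := by
  rw [isIntegrallyClosed_iff K]
  rintro x ⟨p, hp, hpx⟩
  refine ⟨⟨x, mem_completeIntegralClosure_of_forall_mem_idealizer H fun M _ => ?_⟩, rfl⟩
  let φ : completeIntegralClosure R K →+* (H M).idealizer :=
    (algebraMap (completeIntegralClosure R K) K).codRestrict (H M).idealizer.toSubring fun t =>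
      (H M).completeIntegralClosure_subset_idealizer hR (hbot M) t.2
  have hint : IsIntegral (H M).idealizer x :=
    ⟨p.map φ, hp.map φ, by rw [Polynomial.eval₂_map]; exact hpx⟩
  obtain ⟨y, rfl⟩ := IsIntegrallyClosed.isIntegral_iff.1 hint
  exact y.2

theorem dimensionLEOne_completeIntegralClosure :
    Ring.DimensionLEOne (completeIntegralClosure R K) := by
  refine ⟨fun {Q} hQ0 hQ => ?_⟩
  obtain ⟨Q', hQ', hle⟩ := Ideal.exists_le_maximal Q hQ.ne_top
  obtain ⟨M, hM, hM'⟩ := Ideal.exists_le_maximal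
    (Q'.comap (algebraMap R (completeIntegralClosure R K)))
    (Ideal.comap_ne_top _ hQ'.ne_top)
  have hQ'0 : Q' ≠ ⊥ := fun h0 => hQ0 (le_bot_iff.1 (h0 ▸ hle))
  have : Q = Q' := by
    ext t
    rw [mem_iff_valuation_lt_one hR H hbot hQ0 ((Ideal.comap_mono hle).trans hM'),
      mem_iff_valuation_lt_one hR H hbot hQ'0 hM']
  rwa [this]

theorem isDedekindDomain_completeIntegralClosure :
    IsDedekindDomain (completeIntegralClosure R K) := by
  have := isNoetherianRing_completeIntegralClosure hR H hbot
  have := isIntegrallyClosed_completeIntegralClosure hR H hbot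
  have := dimensionLEOne_completeIntegralClosure hR H hbot
  exact {}

/-- Every nonzero prime ideal of `R` is maximal. -/
theorem IsMoriDomain.eq_of_le_isMaximal {P M : Ideal R} [hP : P.IsPrime] [M.IsMaximal]
    (hP0 : P ≠ ⊥) (hPM : P ≤ M) : P = M := by
  refine le_antisymm hPM fun a ha => ?_
  obtain ⟨p, hp, hp0⟩ := Submodule.exists_mem_ne_zero_of_ne_bot hP0
  have hpK : algebraMap R K p ≠ 0 := (map_ne_zero_iff _ (IsFractionRing.injective R K)).2 hp0
  obtain ⟨n, hn⟩ := (H M).exists_pow_mul_mem_idealizer hR (hbot M)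
    ((H M).valuation_algebraMap_lt_one_iff.2 ha) (algebraMap R K p)⁻¹
  obtain ⟨s, hs, r, hr⟩ := localIdeal_subset (hn _ (algebraMap_mem_localIdeal_of_mem ha))
  have e : s * a ^ (n + 1) = r * p := by
    apply IsFractionRing.injective R K
    rw [map_mul, map_mul, ← hr, map_pow, pow_succ]
    field_simp
  have h1 : s * a ^ (n + 1) ∈ P := e ▸ P.mul_mem_left _ hp
  exact hP.mem_of_pow_mem _ ((hP.mem_or_mem h1).resolve_left fun h => hs (hPM h))

theorem isUnibranched_completeIntegralClosure :
    IsUnibranched R (completeIntegralClosure R K) := by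
  intro P hP
  by_cases hP0 : P = ⊥
  · subst hP0
    refine ⟨⊥, ⟨Ideal.isPrime_bot,
      Ideal.comap_bot_of_injective _ algebraMap_completeIntegralClosure_injective⟩, ?_⟩
    rintro Q ⟨-, hQ⟩
    rw [eq_bot_iff]
    intro q hq
    -- The exponent 1 already gives r q ∈ Q ∩ R = 0 with r ≠ 0.
    obtain ⟨r, hr, hrq⟩ := q.2
    obtain ⟨x, hx⟩ := hrq 1
    rw [pow_one, Algebra.smul_def] at hx
    have h1 : algebraMap R (completeIntegralClosure R K) x =
        algebraMap R (completeIntegralClosure R K) r * q := Subtype.ext hx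
    have h2 : x ∈ Q.comap (algebraMap R (completeIntegralClosure R K)) := by
      rw [Ideal.mem_comap, h1]
      exact Q.mul_mem_left _ hq
    rw [hQ, Ideal.mem_bot] at h2
    rw [h2, map_zero] at hx
    rw [Ideal.mem_bot]
    refine Subtype.ext ((mul_eq_zero.1 hx.symm).resolve_left ?_)
    exact (map_ne_zero_iff _ (IsFractionRing.injective R K)).2 (nonZeroDivisors.ne_zero hr)
  · obtain ⟨M, hM, hPM⟩ := Ideal.exists_le_maximal P hP.ne_top
    obtain rfl := hR.eq_of_le_isMaximal H hbot hP0 hPM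
    let V := (H P).idealizer
    let φ : completeIntegralClosure R K →+* V :=
      (algebraMap (completeIntegralClosure R K) K).codRestrict V.toSubring fun t =>
        (H P).completeIntegralClosure_subset_idealizer hR (hbot P) t.2
    refine ⟨(IsLocalRing.maximalIdeal V).comap φ, ⟨Ideal.comap_isPrime _ _, ?_⟩, ?_⟩
    · ext r
      rw [Ideal.mem_comap, Ideal.mem_comap, ValuationSubring.valuation_lt_one_iff]
      exact (H P).valuation_algebraMap_lt_one_iff
    · rintro Q ⟨hQ, hQP⟩
      ext t
      rw [Ideal.mem_comap, ValuationSubring.valuation_lt_one_iff]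
      refine mem_iff_valuation_lt_one hR H hbot ?_ hQP.le
      rintro rfl
      rw [Ideal.comap_bot_of_injective _ algebraMap_completeIntegralClosure_injective] at hQP
      exact hP0 hQP.symm

end Dedekind

/-! ### The degenerate case of a field, and the theorem. -/

section Field

variable {R : Type*} [CommRing R] {K : Type*} [Field K] [Algebra R K]
  [IsFractionRing R K]

theorem isField_completeIntegralClosure [IsDomain R] (hF : IsField R) :
    IsField (completeIntegralClosure R K) := by
  refine ⟨⟨0, 1, zero_ne_one⟩, mul_comm, fun {a} ha => ?_⟩
  obtain ⟨x, y, hy, hxy⟩ := IsFractionRing.div_surjective (A := R) (a : K)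
  have hx : x ≠ 0 := by
    rintro rfl
    rw [map_zero, zero_div] at hxy
    exact ha (Subtype.ext hxy.symm)
  obtain ⟨z, hz⟩ := hF.mul_inv_cancel hx
  refine ⟨algebraMap R _ (y * z), Subtype.ext ?_⟩
  change (a : K) * algebraMap R K (y * z) = 1
  have hyK : algebraMap R K y ≠ 0 :=
    (map_ne_zero_iff _ (IsFractionRing.injective R K)).2 (nonZeroDivisors.ne_zero hy)
  rw [← hxy, map_mul, ← mul_assoc, div_mul_cancel₀ _ hyK, ← map_mul, hz, map_one]

theorem isUnibranched_of_isField {T : Type*} [CommRing T] [Algebra R T] (hF : IsField R)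
    (hT : IsField T) : IsUnibranched R T := by
  let := hF.toField
  let := hT.toField
  intro P hP
  refine ⟨⊥, ⟨Ideal.isPrime_bot, ?_⟩, fun Q hQ => (Ideal.eq_bot_or_top Q).resolve_right
    hQ.1.ne_top⟩
  rw [(Ideal.eq_bot_or_top P).resolve_right hP.ne_top]
  exact (Ideal.eq_bot_or_top _).resolve_right (Ideal.comap_ne_top _ bot_ne_top)

theorem isDedekindDomain_of_isField {T : Type*} [CommRing T] (hT : IsField T) :
    IsDedekindDomain T := by
  let := hT.toField
  infer_instance

end Field

theorem corollary3p7 {R : Type*} [CommRing R] [IsDomain R]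
    (K : Type*) [Field K] [Algebra R K] [IsFractionRing R K] (hR : IsLAPVD R) :
    IsMoriDomain R ↔
      IsDedekindDomain (completeIntegralClosure R K) ∧
        IsUnibranched R (completeIntegralClosure R K) := by
  constructor
  · intro hMori
    -- A field is treated apart because its maximal ideal is zero.
    by_cases hF : IsField R
    · have hT := isField_completeIntegralClosure (K := K) hF
      exact ⟨isDedekindDomain_of_isField hT, isUnibranched_of_isField hF hT⟩
    · have H : ∀ (M : Ideal R) [M.IsMaximal], IsLocallyStronglyPrimary K M := fun M _ =>
        hR.isLocallyStronglyPrimary K M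
      have hbot : ∀ (M : Ideal R) [M.IsMaximal], M ≠ ⊥ := fun M hM =>
        Ring.ne_bot_of_isMaximal_of_not_isField hM hF
      exact ⟨isDedekindDomain_completeIntegralClosure hMori H hbot,
        isUnibranched_completeIntegralClosure hMori H hbot⟩
  · rintro ⟨hD, hU⟩
    exact hR.isMoriDomain K (completeIntegralClosure R K) fun M hM => (hU M hM.isPrime).exists
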